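/- Let $S^2\subset\mathbb R^3$ be the unit sphere with its round metric, surface measure $dV$ and geodesic distance $\mathrm{dist}$, and write $x=(\sin\phi\cos\theta,\sin\phi\sin\theta,\cos\phi)\in S^2$ with $\phi\in[0,\pi]$, $\theta\in[0,2\pi]$. For integers $k\ge 1$ and $-k\le m\le k$ let $$Y^k_m(x)=c_{m,k}\,P^m_k(\cos\phi)\,e^{im\theta}$$ be the standard orthonormal basis of the spherical harmonics of degree $k$. Here $P^m_k$ are the Legendre functions, $$P^m_k(t)=\frac{(-1)^m}{2^k k!}(1-t^2)^{m/2}\frac{d^{k+m}}{dt^{k+m}}(t^2-1)^k\quad(0\le m\le k),\qquad P^{-m}_k=(-1)^m\frac{(k-m)!}{(k+m)!}P^m_k ,$$ and $c_{m,k}>0$ are the constants for which $\|Y^k_m\|_{L^2(S^2,dV)}=1$. Then there is a constant $C$, independent of $k$ and $x$, such that $$\frac1{2k+1}\sum_{m=-k}^k\int_{S^2}|Y^k_m|^4\,dV\le C\log k\qquad\text{for all } k\ge 2 .$$ Moreover, with $\mathbf 1=(0,0,1)$ and $r=r(x)=\min_\pm \mathrm{dist}(x,\pm\mathbf 1)$,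 for all $k\ge 1$ and all $x\in S^2$, $$\Bigl(\sum_{m=-k}^k|Y^k_m(x)|^4\Bigr)^{1/4}\le\begin{cases} C\,k^{1/4}\,r^{-1/4}\bigl(\log(kr)\bigr)^{1/4}, & r\ge 2/k,\\[2pt] C\,k^{1/2}, & r\le 2/k.\end{cases}$$ -/

import Mathlib

open MeasureTheory

noncomputable section

namespace SphHarm

/-- The unit sphere `S²` in Euclidean three-space. -/
abbrev S2 : Type := Metric.sphere (0 : EuclideanSpace ℝ (Fin 3)) 1

/-- The surface measure `dV` of the round metric on `S²` (total mass `4π`). -/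
def dV : Measure S2 := (volume : Measure (EuclideanSpace ℝ (Fin 3))).toSphere

/-- The Legendre polynomial `P_k(t) = 1 / (2^k k!) (d/dt)^k (t² - 1)^k`. -/
def legendrePoly (k : ℕ) : Polynomial ℝ :=
  Polynomial.C (1 / (2 ^ k * (Nat.factorial k : ℝ))) *
    Polynomial.derivative^[k] ((Polynomial.X ^ 2 - 1) ^ k)

/-- The Legendre function of order `m ≥ 0`:
`P^m_k(t) = (-1)^m (1 - t²)^{m/2} (d/dt)^m P_k(t)`. -/
def legendreFunNat (k m : ℕ) (t : ℝ) : ℝ :=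
  (-1) ^ m * Real.sqrt (1 - t ^ 2) ^ m * (Polynomial.derivative^[m] (legendrePoly k)).eval t

/-- The Legendre function `P^m_k(t)` of degree `k` and order `m`, `-k ≤ m ≤ k`; for negative order
`P^{-m}_k = (-1)^m (k-m)!/(k+m)! P^m_k`. -/
def legendreFun (k : ℕ) (m : ℤ) (t : ℝ) : ℝ :=
  if 0 ≤ m then legendreFunNat k m.natAbs t
  else (-1) ^ m.natAbs *
    ((Nat.factorial (k - m.natAbs) : ℝ) / (Nat.factorial (k + m.natAbs) : ℝ)) *
      legendreFunNat k m.natAbs t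

/-- The coordinate `φ ∈ [0, π]` of `x = (sin φ cos θ, sin φ sin θ, cos φ)`. -/
def polarAngle (x : S2) : ℝ := Real.arccos (x.1 2)

/-- The coordinate `θ` (determined mod `2π` away from the poles) of
`x = (sin φ cos θ, sin φ sin θ, cos φ)`. -/
def azimuth (x : S2) : ℝ := Complex.arg ⟨x.1 0, x.1 1⟩

/-- The function `P^m_k(cos φ) e^{imθ}` on `S²`. -/
def unnormalizedY (k : ℕ) (m : ℤ) (x : S2) : ℂ :=
  (legendreFun k m (Real.cos (polarAngle x)) : ℂ) *
    Complex.exp (Complex.I * (m : ℂ) * (azimuth x : ℂ))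

/-- The `L²`-normalizing constant `c_{m,k} = ‖P^m_k(cos φ) e^{imθ}‖_{L²(S²)}⁻¹`. -/
def normConst (m : ℤ) (k : ℕ) : ℝ :=
  (Real.sqrt (∫ x : S2, ‖unnormalizedY k m x‖ ^ 2 ∂dV))⁻¹

/-- The standard basis element `Y^k_m = c_{m,k} P^m_k(cos φ) e^{imθ}`. -/
def Y (k : ℕ) (m : ℤ) (x : S2) : ℂ := (normConst m k : ℂ) * unnormalizedY k m x

/-- The north pole `(0, 0, 1)`. -/
def northPole : EuclideanSpace ℝ (Fin 3) := !₂[0, 0, 1]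

/-- The geodesic distance `r` from `x ∈ S²` to the nearer of the poles `±(0, 0, 1)`; the geodesic
distance of two points of the unit sphere is the angle between them. -/
def poleDist (x : S2) : ℝ :=
  min (InnerProductGeometry.angle x.1 northPole) (InnerProductGeometry.angle x.1 (-northPole))

/-- `Y^k_m` is given by its formula in every choice of coordinates `φ ∈ [0, π]`, `θ ∈ ℝ` of `x`. -/
theorem Y_eq_of_coords (k : ℕ) (m : ℤ) (x : S2) (φ θ : ℝ) (h0 : 0 ≤ φ) (hpi : φ ≤ Real.pi)
    (hx : x.1 = !₂[Real.sin φ * Real.cos θ, Real.sin φ * Real.sin θ, Real.cos φ]) :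
    Y k m x = (normConst m k : ℂ) * ((legendreFun k m (Real.cos φ) : ℂ) *
      Complex.exp (Complex.I * (m : ℂ) * (θ : ℂ))) := by
  have e0 : x.1 0 = Real.sin φ * Real.cos θ := by rw [hx]; simp
  have e1 : x.1 1 = Real.sin φ * Real.sin θ := by rw [hx]; simp
  have e2 : x.1 2 = Real.cos φ := by rw [hx]; simp
  have hp : polarAngle x = φ := by rw [polarAngle, e2, Real.arccos_cos h0 hpi]
  unfold Y unnormalizedY
  rw [hp]
  congr 1
  rcases (Real.sin_nonneg_of_nonneg_of_le_pi h0 hpi).eq_or_lt with hs | hs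
  · by_cases hm : m = 0
    · subst hm; simp
    · have hz : legendreFun k m (Real.cos φ) = 0 := by
        have hq : 1 - Real.cos φ ^ 2 = 0 := by
          rw [← Real.sin_sq, ← hs]; simp
        have : legendreFunNat k m.natAbs (Real.cos φ) = 0 := by
          unfold legendreFunNat
          rw [hq, Real.sqrt_zero, zero_pow (by simpa using hm)]
          simp
        unfold legendreFun
        rw [this]; simp
      rw [hz]; simp
  · congr 1
    have hz : (⟨x.1 0, x.1 1⟩ : ℂ) =
        (Real.sin φ : ℂ) * Complex.exp ((θ : ℂ) * Complex.I) := by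
      rw [e0, e1, Complex.exp_mul_I, ← Complex.ofReal_cos, ← Complex.ofReal_sin]
      apply Complex.ext <;> simp [-Complex.ofReal_sin, -Complex.ofReal_cos]
    have hn : ‖(⟨x.1 0, x.1 1⟩ : ℂ)‖ = Real.sin φ := by
      rw [hz, norm_mul, Complex.norm_exp_ofReal_mul_I, Complex.norm_real, mul_one,
        Real.norm_of_nonneg hs.le]
    have ha := Complex.norm_mul_exp_arg_mul_I (⟨x.1 0, x.1 1⟩ : ℂ)
    rw [hn] at ha
    have hE : Complex.exp ((azimuth x : ℂ) * Complex.I) = Complex.exp ((θ : ℂ) * Complex.I) :=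
      mul_left_cancel₀ (Complex.ofReal_ne_zero.2 hs.ne') (ha.trans hz)
    have key : ∀ t : ℝ, Complex.exp (Complex.I * (m : ℂ) * (t : ℂ)) =
        Complex.exp ((t : ℂ) * Complex.I) ^ m := by
      intro t
      rw [← Complex.exp_int_mul]; congr 1; ring
    rw [key, key, hE]

end SphHarm

end

open Polynomial in
theorem Polynomial.iterate_derivative_X_sq_sub_one_pow_ode {R : Type*} [CommRing R] (k n : ℕ) :
    (X ^ 2 - 1) * derivative^[n + 2] ((X ^ 2 - 1 : R[X]) ^ k)
      + 2 * ((n : R[X]) + 1 - (k : R[X])) * X * derivative^[n + 1] ((X ^ 2 - 1 : R[X]) ^ k)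
      + ((n : R[X]) + 1) * ((n : R[X]) - 2 * (k : R[X])) * derivative^[n] ((X ^ 2 - 1 : R[X]) ^ k) = 0 := by
  have C2 : (C 2 : R[X]) = 2 := rfl
  induction n with
  | zero =>
    have h1 : (X ^ 2 - 1) * derivative ((X ^ 2 - 1 : R[X]) ^ k)
        = 2 * (k : R[X]) * X * (X ^ 2 - 1 : R[X]) ^ k := by
      rcases k with _ | k
      · simp
      · simp [derivative_pow, C2]; ring
    have h2 := congrArg derivative h1
    simp only [derivative_mul, derivative_sub, derivative_one, derivative_X_pow, derivative_X,
      derivative_natCast, derivative_ofNat] at h2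
    simp only [Function.iterate_succ_apply', Function.iterate_zero, id]
    simp [C2] at h2 ⊢
    linear_combination h2
  | succ n ih =>
    have h2 := congrArg derivative ih
    simp only [derivative_mul, derivative_add, derivative_sub, derivative_one, derivative_X_pow,
      derivative_X, derivative_natCast, derivative_ofNat, ← Function.iterate_succ_apply'] at h2
    simp only [map_natCast] at h2
    simp [-Function.iterate_succ] at h2 ⊢
    linear_combination h2

open Polynomial in
theorem Polynomial.eval_one_iterate_derivative_X_sq_sub_one_pow_add {R : Type*} [CommRing R]
    (k i : ℕ) : (derivative^[k + i] ((X ^ 2 - 1 : R[X]) ^ k)).eval 1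
      = ((k + i).factorial : R) * (2 ^ (k - i) * (k.choose i : R)) := by
  have h : taylor 1 ((X ^ 2 - 1 : R[X]) ^ k) = X ^ k * (X + C 2) ^ k := by
    rw [taylor_pow, ← mul_pow]
    congr 1
    simp [taylor_apply]
    have : (C 2 : R[X]) = 2 := rfl
    rw [this]; ring
  have h2 := taylor_coeff 1 (k + i) (f := ((X ^ 2 - 1 : R[X]) ^ k))
  rw [h, add_comm k i, coeff_X_pow_mul, coeff_X_add_C_pow] at h2
  rw [h2, add_comm k i, ← factorial_smul_hasseDeriv]
  simp

open Polynomial in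
theorem Polynomial.eval_one_iterate_derivative_X_sq_sub_one_pow_of_lt {R : Type*} [CommRing R]
    {k j : ℕ} (hj : j < k) : (derivative^[j] ((X ^ 2 - 1 : R[X]) ^ k)).eval 1 = 0 := by
  have h : ((X ^ 2 - 1 : R[X]) ^ k) = (X - C 1) ^ k * (X + 1) ^ k := by
    rw [← mul_pow]; congr 1; simp; ring
  obtain ⟨g, hg⟩ := pow_sub_dvd_iterate_derivative_of_pow_dvd (n := k) j
    (p := ((X ^ 2 - 1 : R[X]) ^ k)) (q := X - C 1) (Dvd.intro _ h.symm)
  rw [hg]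
  simp [zero_pow (show k - j ≠ 0 by omega)]

open Polynomial in
theorem Polynomial.eval_neg_one_iterate_derivative_X_sq_sub_one_pow_of_lt {R : Type*} [CommRing R]
    {k j : ℕ} (hj : j < k) : (derivative^[j] ((X ^ 2 - 1 : R[X]) ^ k)).eval (-1) = 0 := by
  have h : ((X ^ 2 - 1 : R[X]) ^ k) = (X - C (-1)) ^ k * (X - 1) ^ k := by
    rw [← mul_pow]; congr 1; simp; ring
  obtain ⟨g, hg⟩ := pow_sub_dvd_iterate_derivative_of_pow_dvd (n := k) j
    (p := ((X ^ 2 - 1 : R[X]) ^ k)) (q := X - C (-1)) (Dvd.intro _ h.symm)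
  rw [hg]
  simp [zero_pow (show k - j ≠ 0 by omega)]

open Polynomial in
theorem Polynomial.eq_of_derivative_eq_of_eval_eq {R : Type*} [CommRing R] [IsDomain R] [CharZero R]
    {p q : R[X]} {a : R} (h : derivative p = derivative q) (ha : p.eval a = q.eval a) : p = q := by
  have h1 : derivative (p - q) = 0 := by rw [derivative_sub, h, sub_self]
  have h2 := derivative_eq_zero.1 h1
  obtain ⟨c, hc⟩ := natDegree_eq_zero.1 h2
  have h3 : (p - q).eval a = 0 := by simp [ha]
  rw [← hc, eval_C] at h3
  rw [h3, C_0] at hc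
  exact sub_eq_zero.1 hc.symm

open Polynomial in
/-- The two ways to write the Legendre function of opposite orders by the Rodrigues formula. -/
theorem Polynomial.rodrigues_symm {R : Type*} [CommRing R] [IsDomain R] [CharZero R] {k m : ℕ}
    (hm : m ≤ k) :
    ((k + m).factorial : R[X]) * derivative^[k - m] ((X ^ 2 - 1 : R[X]) ^ k)
      = ((k - m).factorial : R[X]) *
        ((X ^ 2 - 1) ^ m * derivative^[k + m] ((X ^ 2 - 1 : R[X]) ^ k)) := by
  induction m with
  | zero => simp
  | succ m ih =>
    have ih := ih (by omega)
    obtain ⟨l, rfl⟩ : ∃ l, k = m + 1 + l := ⟨k - (m + 1), by omega⟩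
    set k := m + 1 + l with hk
    have e1 : k - m = l + 1 := by omega
    have e2 : k - (m + 1) = l := by omega
    have e3 : k + (m + 1) = k + m + 1 := by omega
    rw [e1] at ih
    rw [e2, e3]
    apply eq_of_derivative_eq_of_eval_eq (a := 1)
    · have ode := iterate_derivative_X_sq_sub_one_pow_ode (R := R) k (k + m)
      have e4 : (k : R[X]) = m + 1 + l := by rw [hk]; push_cast; ring
      rw [Nat.factorial_succ] at ih ⊢
      simp only [derivative_mul, derivative_natCast, derivative_pow, derivative_sub, derivative_one,
        derivative_X, ← Function.iterate_succ_apply', zero_mul, zero_add]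
      push_cast at ih ode ⊢
      rw [show C ((m : R) + 1) = (m : R[X]) + 1 by simp, show (C 2 : R[X]) = 2 from rfl]
      rw [e4] at ode ⊢
      linear_combination (m + 1 + l + m + 1 : R[X]) * ih
        - (l.factorial : R[X]) * (X ^ 2 - 1) ^ m * ode
    · rw [eval_mul, eval_one_iterate_derivative_X_sq_sub_one_pow_of_lt (by omega)]
      simp

open Polynomial in
theorem Polynomial.sum_alternating_derivative_eval_eq {R : Type*} [CommRing R] [IsDomain R]
    [CharZero R] (n : ℕ) {f g : R[X]} (hf : f.natDegree ≤ n) (hg : g.natDegree ≤ n) (a b : R) :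
    ∑ j ∈ Finset.range (n + 1), (-1) ^ j * (derivative^[j] f).eval a *
        (derivative^[n - j] g).eval a
      = ∑ j ∈ Finset.range (n + 1), (-1) ^ j * (derivative^[j] f).eval b *
        (derivative^[n - j] g).eval b := by
  set H : R[X] := ∑ j ∈ Finset.range (n + 1), (-1) ^ j * derivative^[j] f * derivative^[n - j] g
    with hH
  have hd : derivative H = 0 := by
    have key : ∀ j ∈ Finset.range (n + 1),
        derivative ((-1) ^ j * derivative^[j] f * derivative^[n - j] g)
          = (-1) ^ j * derivative^[j] f * derivative^[n + 1 - j] g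
            - (-1) ^ (j + 1) * derivative^[j + 1] f * derivative^[n + 1 - (j + 1)] g := by
      intro j hj
      have hj' : n + 1 - j = (n - j) + 1 := by have := Finset.mem_range.1 hj; omega
      have h1 : derivative ((-1 : R[X]) ^ j) = 0 := by
        rw [show ((-1 : R[X]) ^ j) = C ((-1) ^ j) by simp, derivative_C]
      rw [derivative_mul, derivative_mul, h1, hj', Function.iterate_succ_apply',
        Function.iterate_succ_apply', Nat.add_sub_add_right]
      ring
    rw [hH, derivative_sum, Finset.sum_congr rfl key, Finset.sum_range_sub'
      (fun j => (-1 : R[X]) ^ j * derivative^[j] f * derivative^[n + 1 - j] g),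
      iterate_derivative_eq_zero (p := f) (x := n + 1) (by omega),
      iterate_derivative_eq_zero (p := g) (x := n + 1 - 0) (by omega)]
    simp
  obtain ⟨c, hc⟩ := natDegree_eq_zero.1 (derivative_eq_zero.1 hd)
  have h1 : ∀ x, H.eval x = ∑ j ∈ Finset.range (n + 1), (-1) ^ j * (derivative^[j] f).eval x *
        (derivative^[n - j] g).eval x := by
    intro x; simp [hH, eval_finsetSum]
  rw [← h1, ← h1, ← hc, eval_C, eval_C]

open Polynomial in
theorem Polynomial.iterate_derivative_comp_affine {R : Type*} [CommRing R] (p : R[X]) (a b : R)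
    (n : ℕ) : derivative^[n] (p.comp (C a * X + C b))
      = C a ^ n * (derivative^[n] p).comp (C a * X + C b) := by
  induction n with
  | zero => simp
  | succ n ih =>
    rw [Function.iterate_succ_apply', ih, Function.iterate_succ_apply', ← C_pow, derivative_C_mul,
      derivative_comp]
    simp
    ring

open Polynomial in
theorem Polynomial.eval_add_eq_sum_iterate_derivative {K : Type*} [Field K] [CharZero K] {n : ℕ}
    {f : K[X]} (hf : f.natDegree ≤ n) (c h : K) :
    f.eval (c + h) = ∑ i ∈ Finset.range (n + 1),
      h ^ i / (i.factorial : K) * (derivative^[i] f).eval c := by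
  rw [add_comm c h, ← taylor_eval, eval_eq_sum_range' (n := n + 1) (by rw [natDegree_taylor]; omega)]
  refine Finset.sum_congr rfl fun i _ => ?_
  have : (i.factorial : K) ≠ 0 := by exact_mod_cast i.factorial_ne_zero
  rw [taylor_coeff, ← factorial_smul_hasseDeriv]
  simp
  field_simp

open Polynomial in
theorem Polynomial.natDegree_X_sq_sub_one_pow_le {R : Type*} [CommRing R] (k : ℕ) :
    ((X ^ 2 - 1 : R[X]) ^ k).natDegree ≤ 2 * k := by
  refine natDegree_pow_le.trans ?_
  rw [mul_comm]
  gcongr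
  compute_degree

open Polynomial in
theorem Polynomial.sum_iterate_derivative_X_sq_sub_one_pow_mul {K : Type*} [Field K] [CharZero K]
    (k : ℕ) (t ζ : K) (hζ : ζ ≠ 0) :
    ∑ j ∈ Finset.range (2 * k + 1), (-1) ^ j * ζ ^ (2 * k - j) *
        (derivative^[j] ((X ^ 2 - 1 : K[X]) ^ k)).eval t *
        (derivative^[2 * k - j] ((X ^ 2 - 1 : K[X]) ^ k)).eval t
      = (-1) ^ k * ζ ^ k * 2 ^ k * (k.factorial : K) *
        (derivative^[k] ((X ^ 2 - 1 : K[X]) ^ k)).eval (t ^ 2 + (1 - t ^ 2) * ((ζ + ζ⁻¹) / 2)) := by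
  set w : K[X] := (X ^ 2 - 1) ^ k with hw
  have hwd : w.natDegree ≤ 2 * k := natDegree_X_sq_sub_one_pow_le k
  have hg : (w.comp (C ζ * X + C (t - ζ * t))).natDegree ≤ 2 * k := by
    refine natDegree_comp_le.trans ?_
    calc _ ≤ w.natDegree * 1 := by gcongr; compute_degree
      _ ≤ 2 * k := by omega
  have hmain := sum_alternating_derivative_eval_eq (2 * k) hwd hg t 1
  simp only [iterate_derivative_comp_affine, eval_mul, eval_pow, eval_C, eval_comp, eval_add,
    eval_X, mul_one, add_sub_cancel] at hmain
  obtain ⟨c, hc⟩ : ∃ c, c = ζ + (t - ζ * t) := ⟨_, rfl⟩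
  rw [← hc] at hmain
  have hright : ∑ j ∈ Finset.range (2 * k + 1), (-1) ^ j * (derivative^[j] w).eval 1 *
        (ζ ^ (2 * k - j) * (derivative^[2 * k - j] w).eval c)
      = (-1) ^ k * ζ ^ k * 2 ^ k * (k.factorial : K) *
        (derivative^[k] w).eval (c + -((c ^ 2 - 1) / (2 * ζ))) := by
    rw [eval_add_eq_sum_iterate_derivative (n := k)
      ((natDegree_iterate_derivative w k).trans (by omega)),
      show 2 * k + 1 = k + (k + 1) by ring, Finset.sum_range_add, Finset.sum_eq_zero, zero_add,
      Finset.mul_sum]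
    · refine Finset.sum_congr rfl fun i hi => ?_
      obtain ⟨l, hl⟩ : ∃ l, k = l + i := ⟨k - i, by have := Finset.mem_range.1 hi; omega⟩
      have hr := congrArg (eval c) (rodrigues_symm (R := K) (k := k) (m := i) (by omega))
      simp only [eval_mul, eval_pow, eval_sub, eval_X, eval_one, eval_natCast] at hr
      have hch := Nat.add_choose_mul_factorial_mul_factorial l i
      rw [← hl] at hch
      have hch' : (k.choose i : K) * (l.factorial : K) * (i.factorial : K) = (k.factorial : K) := by
        exact_mod_cast hch
      have hi0 : (i.factorial : K) ≠ 0 := by exact_mod_cast i.factorial_ne_zero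
      rw [hw, eval_one_iterate_derivative_X_sq_sub_one_pow_add, ← hw,
        show 2 * k - (k + i) = l by omega, show k - i = l by omega,
        ← Function.iterate_add_apply, add_comm i k]
      rw [← hw, show k - i = l by omega] at hr
      have h3 : ((k + i).factorial : K) * (2 ^ l * (k.choose i : K)) *
          (ζ ^ l * (derivative^[l] w).eval c) =
          2 ^ l * ζ ^ l * ((k.factorial : K) / (i.factorial : K)) * (c ^ 2 - 1) ^ i *
            (derivative^[k + i] w).eval c := by
        rw [← hch']
        field_simp
        linear_combination (k.choose i : K) * hr
      have h4 : (-((c ^ 2 - 1) / (2 * ζ))) ^ i * ((2 * ζ) ^ l * (2 * ζ) ^ i) =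
          (-1) ^ i * (c ^ 2 - 1) ^ i * (2 * ζ) ^ l := by
        rw [neg_pow, div_pow]
        field_simp
      have h5 : (2 * ζ) ^ k = (2 * ζ) ^ l * (2 * ζ) ^ i := by rw [hl, pow_add]
      rw [← h5, mul_pow, mul_pow] at h4
      rw [mul_assoc ((-1 : K) ^ (k + i)), h3]
      field_simp
      rw [pow_add]
      linear_combination -(-1) ^ k * (k.factorial : K) * (derivative^[k + i] w).eval c * h4
    · intro j hj
      rw [hw, eval_one_iterate_derivative_X_sq_sub_one_pow_of_lt (Finset.mem_range.1 hj)]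
      ring
  rw [hright] at hmain
  have harg : c + -((c ^ 2 - 1) / (2 * ζ)) = t ^ 2 + (1 - t ^ 2) * ((ζ + ζ⁻¹) / 2) := by
    rw [hc]; field_simp; ring
  rw [harg] at hmain
  rw [← hmain]
  refine Finset.sum_congr rfl fun j _ => ?_
  ring

namespace SphHarm

open Polynomial in
/-- The coefficient of `e^{imθ}`, `|m| = n`, in the addition theorem for the Legendre polynomial,
as a polynomial in `cos φ`. -/
noncomputable def additionCoeff (k n : ℕ) : ℝ[X] :=
  C ((Nat.factorial (k - n) : ℝ) / (Nat.factorial (k + n) : ℝ)) * (1 - X ^ 2) ^ n *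
    (derivative^[n] (legendrePoly k)) ^ 2

open Polynomial in
theorem iterate_derivative_legendrePoly (k n : ℕ) :
    derivative^[n] (legendrePoly k) = C (1 / (2 ^ k * (Nat.factorial k : ℝ))) *
      derivative^[k + n] ((X ^ 2 - 1) ^ k) := by
  rw [legendrePoly, iterate_derivative_C_mul, ← Function.iterate_add_apply, add_comm n k]

open Polynomial in
theorem additionCoeff_eq {k n : ℕ} (hn : n ≤ k) :
    C (4 ^ k * (Nat.factorial k : ℝ) ^ 2) * additionCoeff k n = (-1) ^ n *
      derivative^[k + n] ((X ^ 2 - 1) ^ k) * derivative^[k - n] ((X ^ 2 - 1) ^ k) := by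
  have h := rodrigues_symm (R := ℝ) hn
  have h1 : ((k + n).factorial : ℝ) ≠ 0 := by exact_mod_cast (k + n).factorial_ne_zero
  have h2 : (k.factorial : ℝ) ≠ 0 := by exact_mod_cast k.factorial_ne_zero
  have h4 : ((k + n).factorial : ℝ[X]) ≠ 0 := by exact_mod_cast (k + n).factorial_ne_zero
  have h3 : (C (4 ^ k * (Nat.factorial k : ℝ) ^ 2) : ℝ[X]) *
      C ((Nat.factorial (k - n) : ℝ) / (Nat.factorial (k + n) : ℝ)) *
      C (1 / (2 ^ k * (Nat.factorial k : ℝ))) ^ 2 * ((k + n).factorial : ℝ[X]) =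
      ((k - n).factorial : ℝ[X]) := by
    rw [← C_eq_natCast, ← C_eq_natCast, ← C_pow, ← C_mul, ← C_mul, ← C_mul]
    congr 1
    rw [show (4 : ℝ) = 2 ^ 2 by norm_num, ← pow_mul, mul_comm 2 k, pow_mul]
    field_simp
  rw [additionCoeff, iterate_derivative_legendrePoly]
  apply mul_left_cancel₀ h4
  rw [show (1 - X ^ 2 : ℝ[X]) = (-1) * (X ^ 2 - 1) by ring, mul_pow (-1 : ℝ[X])]
  linear_combination ((-1) ^ n * (X ^ 2 - 1) ^ n * derivative^[k + n] ((X ^ 2 - 1) ^ k) ^ 2) * h3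
    - (-1) ^ n * derivative^[k + n] ((X ^ 2 - 1) ^ k) * h

open Polynomial in
/-- The addition theorem for two points of the sphere of equal latitude. -/
theorem legendrePoly_addition (k : ℕ) (t θ : ℝ) :
    (((legendrePoly k).eval (t ^ 2 + (1 - t ^ 2) * Real.cos θ) : ℝ) : ℂ) =
      ∑ m ∈ Finset.Icc (-(k : ℤ)) (k : ℤ), (((additionCoeff k m.natAbs).eval t : ℝ) : ℂ) *
        Complex.exp (Complex.I * (m : ℂ) * (θ : ℂ)) := by
  set ζ : ℂ := Complex.exp (-(θ * Complex.I)) with hζ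
  have hζ0 : ζ ≠ 0 := Complex.exp_ne_zero _
  have hmain := sum_iterate_derivative_X_sq_sub_one_pow_mul k (t : ℂ) ζ hζ0
  have harg : ((t : ℂ) ^ 2 + (1 - (t : ℂ) ^ 2) * ((ζ + ζ⁻¹) / 2)) =
      ((t ^ 2 + (1 - t ^ 2) * Real.cos θ : ℝ) : ℂ) := by
    push_cast
    rw [Complex.cos, hζ, Complex.exp_neg, inv_inv, neg_mul, Complex.exp_neg]
    ring
  have hcast : ∀ (j : ℕ) (x : ℝ), (derivative^[j] ((X ^ 2 - 1 : ℂ[X]) ^ k)).eval (x : ℂ) =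
      (((derivative^[j] ((X ^ 2 - 1 : ℝ[X]) ^ k)).eval x : ℝ) : ℂ) := by
    intro j x
    have : ((X ^ 2 - 1 : ℂ[X]) ^ k) = ((X ^ 2 - 1 : ℝ[X]) ^ k).map Complex.ofRealHom := by simp
    rw [this, iterate_derivative_map]
    exact eval_map_apply Complex.ofRealHom x
  rw [harg] at hmain
  simp only [hcast] at hmain
  have h0 : ((-1) ^ k * ζ ^ k * 4 ^ k * (k.factorial : ℂ) ^ 2) ≠ 0 := by
    have : (k.factorial : ℂ) ≠ 0 := by exact_mod_cast k.factorial_ne_zero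
    simp [hζ0, this]
  apply mul_left_cancel₀ h0
  have hL : ((-1) ^ k * ζ ^ k * 4 ^ k * (k.factorial : ℂ) ^ 2) *
      (((legendrePoly k).eval (t ^ 2 + (1 - t ^ 2) * Real.cos θ) : ℝ) : ℂ) =
      (-1) ^ k * ζ ^ k * 2 ^ k * (k.factorial : ℂ) *
        (((derivative^[k] ((X ^ 2 - 1 : ℝ[X]) ^ k)).eval
          (t ^ 2 + (1 - t ^ 2) * Real.cos θ) : ℝ) : ℂ) := by
    have : (k.factorial : ℂ) ≠ 0 := by exact_mod_cast k.factorial_ne_zero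
    rw [legendrePoly, eval_mul, eval_C, show (4 : ℂ) = 2 * 2 by norm_num, mul_pow]
    push_cast
    field_simp
  rw [hL, ← hmain, Finset.mul_sum]
  symm
  refine Finset.sum_bij' (fun m _ => (m + k).toNat) (fun j _ => (j : ℤ) - k) ?_ ?_ ?_ ?_ ?_
  · intro m hm; simp at hm ⊢; omega
  · intro j hj; simp at hj ⊢; omega
  · intro m hm; simp at hm ⊢; omega
  · intro j hj; simp
  · intro m hm
    simp only [Finset.mem_Icc] at hm
    have hn : m.natAbs ≤ k := by omega
    have hc := congrArg (eval t) (additionCoeff_eq hn)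
    simp only [eval_mul, eval_C, eval_pow, eval_neg, eval_one] at hc
    have hc' := congrArg (fun x : ℝ => (x : ℂ)) hc
    push_cast at hc'
    have hE : Complex.exp (Complex.I * (m : ℂ) * (θ : ℂ)) = ζ ^ (-m) := by
      rw [hζ, ← Complex.exp_int_mul]; congr 1; push_cast; ring
    have hz : ζ ^ k * ζ ^ (-m) = ζ ^ (2 * k - (m + k).toNat) := by
      rw [← zpow_natCast, ← zpow_natCast, ← zpow_add₀ hζ0]; congr 1; omega
    rw [hE]
    have hs : (-1 : ℂ) ^ k * (-1) ^ m.natAbs = (-1) ^ (m + k).toNat := by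
      rw [← pow_add, neg_one_pow_eq_pow_mod_two, neg_one_pow_eq_pow_mod_two (n := (m + k).toNat)]
      congr 1; omega
    rw [← hz, ← hs]
    rcases le_or_gt 0 m with h | h
    · rw [show (m + k).toNat = k + m.natAbs by omega,
        show 2 * k - (k + m.natAbs) = k - m.natAbs by omega]
      linear_combination ((-1) ^ k * ζ ^ k * ζ ^ (-m)) * hc'
    · rw [show (m + k).toNat = k - m.natAbs by omega,
        show 2 * k - (k - m.natAbs) = k + m.natAbs by omega]
      linear_combination ((-1) ^ k * ζ ^ k * ζ ^ (-m)) * hc'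

open Polynomial in
theorem eval_one_legendrePoly (k : ℕ) : (legendrePoly k).eval 1 = 1 := by
  have h := eval_one_iterate_derivative_X_sq_sub_one_pow_add (R := ℝ) k 0
  have : (k.factorial : ℝ) ≠ 0 := by exact_mod_cast k.factorial_ne_zero
  rw [add_zero] at h
  rw [legendrePoly, eval_mul, h]
  simp
  field_simp

open Polynomial in
theorem sum_additionCoeff (k : ℕ) (t : ℝ) :
    ∑ m ∈ Finset.Icc (-(k : ℤ)) (k : ℤ), (additionCoeff k m.natAbs).eval t = 1 := by
  have h := legendrePoly_addition k t 0
  simp only [Real.cos_zero, mul_one, add_sub_cancel, eval_one_legendrePoly, Complex.ofReal_zero,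
    mul_zero, Complex.exp_zero] at h
  exact_mod_cast h.symm

open Polynomial in
theorem additionCoeff_nonneg (k n : ℕ) {t : ℝ} (ht : t ^ 2 ≤ 1) :
    0 ≤ (additionCoeff k n).eval t := by
  have : 0 ≤ 1 - t ^ 2 := by linarith
  simp [additionCoeff]
  positivity

open Polynomial in
theorem sq_eval_legendrePoly_le_one (k : ℕ) {t : ℝ} (ht : t ^ 2 ≤ 1) :
    (legendrePoly k).eval t ^ 2 ≤ 1 := by
  rw [← sum_additionCoeff k t]
  have h := Finset.single_le_sum (f := fun m : ℤ => (additionCoeff k m.natAbs).eval t)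
    (fun m _ => additionCoeff_nonneg k m.natAbs ht)
    (show (0 : ℤ) ∈ Finset.Icc (-(k : ℤ)) (k : ℤ) by simp)
  refine le_trans (le_of_eq ?_) h
  have : (k.factorial : ℝ) ≠ 0 := by exact_mod_cast k.factorial_ne_zero
  simp [additionCoeff, this]

open Polynomial in
theorem integral_additionCoeff_succ {k n : ℕ} (hn : n + 1 ≤ k) :
    ∫ t in (-1 : ℝ)..1, (additionCoeff k (n + 1)).eval t =
      ∫ t in (-1 : ℝ)..1, (additionCoeff k n).eval t := by
  have h0 : (4 ^ k * (Nat.factorial k : ℝ) ^ 2) ≠ 0 := by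
    have : (k.factorial : ℝ) ≠ 0 := by exact_mod_cast k.factorial_ne_zero
    positivity
  apply mul_left_cancel₀ h0
  rw [← intervalIntegral.integral_const_mul, ← intervalIntegral.integral_const_mul]
  have key : ∀ l ≤ k, ∀ t : ℝ, 4 ^ k * (Nat.factorial k : ℝ) ^ 2 * (additionCoeff k l).eval t =
      (-1) ^ l * ((derivative^[k - l] ((X ^ 2 - 1 : ℝ[X]) ^ k)).eval t *
        (derivative^[k + l] ((X ^ 2 - 1 : ℝ[X]) ^ k)).eval t) := by
    intro l hl t
    have h := congrArg (eval t) (additionCoeff_eq hl)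
    simp only [eval_mul, eval_C, eval_pow, eval_neg, eval_one] at h
    linear_combination h
  simp only [key _ hn, key n (by omega), intervalIntegral.integral_const_mul]
  have hs : k - n = (k - (n + 1)) + 1 := by omega
  have parts := intervalIntegral.integral_mul_deriv_eq_deriv_mul (a := (-1 : ℝ)) (b := 1)
    (u := fun t => (derivative^[k - (n + 1)] ((X ^ 2 - 1 : ℝ[X]) ^ k)).eval t)
    (v := fun t => (derivative^[k + n] ((X ^ 2 - 1 : ℝ[X]) ^ k)).eval t)
    (fun t _ => Polynomial.hasDerivAt _ t) (fun t _ => Polynomial.hasDerivAt _ t)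
    ((Polynomial.continuous _).intervalIntegrable _ _)
    ((Polynomial.continuous _).intervalIntegrable _ _)
  simp only [← Function.iterate_succ_apply' (f := (derivative : ℝ[X] →ₗ[ℝ] ℝ[X]))] at parts
  rw [hs, ← add_assoc, parts,
    eval_one_iterate_derivative_X_sq_sub_one_pow_of_lt (by omega),
    eval_neg_one_iterate_derivative_X_sq_sub_one_pow_of_lt (by omega), pow_succ]
  ring

open Polynomial in
theorem integral_additionCoeff {k n : ℕ} (hn : n ≤ k) :
    ∫ t in (-1 : ℝ)..1, (additionCoeff k n).eval t = 2 / (2 * (k : ℝ) + 1) := by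
  have h0 : ∀ l ≤ k, ∫ t in (-1 : ℝ)..1, (additionCoeff k l).eval t =
      ∫ t in (-1 : ℝ)..1, (additionCoeff k 0).eval t := by
    intro l
    induction l with
    | zero => intro _; rfl
    | succ l ih => intro hl; rw [integral_additionCoeff_succ hl, ih (by omega)]
  have h1 : ∑ m ∈ Finset.Icc (-(k : ℤ)) (k : ℤ),
      ∫ t in (-1 : ℝ)..1, (additionCoeff k m.natAbs).eval t = 2 := by
    rw [← intervalIntegral.integral_finsetSum
      (fun m _ => (Polynomial.continuous _).intervalIntegrable _ _)]
    simp only [sum_additionCoeff]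
    norm_num
  rw [Finset.sum_congr rfl (fun m hm => h0 m.natAbs (by simp at hm; omega)), Finset.sum_const,
    Int.card_Icc, show ((k : ℤ) + 1 - -(k : ℤ)).toNat = 2 * k + 1 by omega, nsmul_eq_mul] at h1
  rw [h0 n hn]
  push_cast at h1
  field_simp
  linarith

open Polynomial in
theorem legendrePoly_ode (k : ℕ) (t : ℝ) :
    (1 - t ^ 2) * (derivative (derivative (legendrePoly k))).eval t =
      2 * t * (derivative (legendrePoly k)).eval t - k * (k + 1) * (legendrePoly k).eval t := by
  have h := congrArg (eval t) (iterate_derivative_X_sq_sub_one_pow_ode (R := ℝ) k k)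
  have h0 := iterate_derivative_legendrePoly k 0
  have h1 := iterate_derivative_legendrePoly k 1
  have h2 := iterate_derivative_legendrePoly k 2
  simp only [Function.iterate_succ_apply', Function.iterate_zero, id, add_zero] at h h0 h1 h2
  rw [h2, h1, h0]
  simp only [eval_mul, eval_C]
  simp at h
  linear_combination -(1 / (2 ^ k * (Nat.factorial k : ℝ))) * h

open Polynomial in
/-- The energy `(1 - t²) P_k'(t)² + k (k + 1) P_k(t)²` is smallest at `t = 0`, so it is at most its
mean there. -/
theorem legendrePoly_energy_zero_le {k : ℕ} (hk : 1 ≤ k) :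
    (derivative (legendrePoly k)).eval 0 ^ 2 + k * (k + 1) * (legendrePoly k).eval 0 ^ 2 ≤
      2 * (k * (k + 1)) / (2 * (k : ℝ) + 1) := by
  set p := legendrePoly k with hp
  set E : ℝ → ℝ := fun t => (1 - t ^ 2) * (derivative p).eval t ^ 2 + k * (k + 1) * p.eval t ^ 2
    with hE
  have hd : ∀ t, HasDerivAt E (2 * t * (derivative p).eval t ^ 2) t := by
    intro t
    have h := (((hasDerivAt_id t).pow 2).const_sub 1 |>.mul
      (((derivative p).hasDerivAt t).pow 2)).add
      (((p.hasDerivAt t).pow 2).const_mul ((k : ℝ) * (k + 1)))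
    refine h.congr_deriv ?_
    have := legendrePoly_ode k t
    rw [← hp] at this
    simp
    linear_combination (2 * eval t (derivative p)) * this
  have hmin : ∀ t, E 0 ≤ E t := by
    intro t
    have hc : Continuous E := continuous_iff_continuousAt.2 fun t => (hd t).continuousAt
    rcases le_total 0 t with h | h
    · refine monotoneOn_of_deriv_nonneg (convex_Ici 0) hc.continuousOn
        (fun x _ => (hd x).differentiableAt.differentiableWithinAt) ?_ (Set.self_mem_Ici) h h
      intro x hx
      rw [(hd x).deriv]
      simp at hx
      positivity
    · refine antitoneOn_of_deriv_nonpos (convex_Iic 0) hc.continuousOn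
        (fun x _ => (hd x).differentiableAt.differentiableWithinAt) ?_ h (Set.self_mem_Iic) h
      intro x hx
      rw [(hd x).deriv]
      simp at hx
      nlinarith [sq_nonneg (eval x (derivative p))]
  have hEeq : ∀ t, E t = (k * (k + 1)) * ((additionCoeff k 1).eval t + (additionCoeff k 0).eval t) := by
    intro t
    obtain ⟨l, rfl⟩ : ∃ l, k = l + 1 := ⟨k - 1, by omega⟩
    have h2 : (l.factorial : ℝ) ≠ 0 := by exact_mod_cast l.factorial_ne_zero
    simp [hE, additionCoeff, ← hp, Nat.factorial_succ]
    field_simp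
  have hint : ∫ t in (-1 : ℝ)..1, E t = 4 * (k * (k + 1)) / (2 * (k : ℝ) + 1) := by
    simp only [hEeq]
    rw [intervalIntegral.integral_const_mul, intervalIntegral.integral_add
      ((Polynomial.continuous _).intervalIntegrable _ _)
      ((Polynomial.continuous _).intervalIntegrable _ _), integral_additionCoeff hk,
      integral_additionCoeff (Nat.zero_le k)]
    ring
  have hle : ∫ t in (-1 : ℝ)..1, E 0 ≤ ∫ t in (-1 : ℝ)..1, E t :=
    intervalIntegral.integral_mono_on (by norm_num) (by simp)
      ((continuous_iff_continuousAt.2 fun t => (hd t).continuousAt).intervalIntegrable _ _)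
      (fun t _ => hmin t)
  rw [hint, intervalIntegral.integral_const] at hle
  simp [hE] at hle
  have : 4 * ((k : ℝ) * (k + 1)) / (2 * (k : ℝ) + 1) = 2 * (2 * (k * (k + 1)) / (2 * (k : ℝ) + 1)) := by
    ring
  linarith

open Polynomial in
/-- Bernstein's inequality for Legendre polynomials. -/
theorem sqrt_mul_sq_eval_legendrePoly_le {k : ℕ} (hk : 1 ≤ k) {t : ℝ} (ht : t ^ 2 ≤ 1) :
    Real.sqrt (1 - t ^ 2) * (legendrePoly k).eval t ^ 2 ≤ 2 / (2 * (k : ℝ) + 1) := by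
  rcases ht.eq_or_lt with ht1 | ht1
  · rw [ht1, sub_self, Real.sqrt_zero, zero_mul]; positivity
  have hk' : (0 : ℝ) < k := by exact_mod_cast hk
  set p := legendrePoly k with hp
  set M : ℝ := 4 * (k * (k + 1)) + 1 with hM
  have hM0 : 0 < M := by positivity
  set N : ℝ → ℝ := fun t => p.eval t ^ 2 * (M * (1 - t ^ 2) + 1) +
    (2 * (1 - t ^ 2) * (derivative p).eval t - t * p.eval t) ^ 2 with hN
  set S : ℝ → ℝ := fun t => Real.sqrt (1 - t ^ 2) * N t / (M * (1 - t ^ 2) + 1) with hS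
  have hd : ∀ t : ℝ, t ^ 2 < 1 → HasDerivAt S (-(2 * t *
      (2 * (1 - t ^ 2) * (derivative p).eval t - t * p.eval t) ^ 2 /
        (Real.sqrt (1 - t ^ 2) * (M * (1 - t ^ 2) + 1) ^ 2))) t := by
    intro t ht
    have ha : 0 < 1 - t ^ 2 := by linarith
    have hB : 0 < M * (1 - t ^ 2) + 1 := by positivity
    have da : HasDerivAt (fun t : ℝ => 1 - t ^ 2) (-(2 * t)) t := by
      have := ((hasDerivAt_id t).pow 2).const_sub 1
      simpa using this
    have dB : HasDerivAt (fun t : ℝ => M * (1 - t ^ 2) + 1) (M * (-(2 * t))) t :=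
      (da.const_mul M).add_const 1
    have dp := p.hasDerivAt t
    have dq := (derivative p).hasDerivAt t
    have dN := ((dp.pow 2).mul dB).add
      ((((da.const_mul 2).mul dq).sub ((hasDerivAt_id t).mul dp)).pow 2)
    have h := ((da.sqrt ha.ne').mul dN).div dB hB.ne'
    refine h.congr_deriv ?_
    have ode := legendrePoly_ode k t
    rw [← hp] at ode
    have hsq : Real.sqrt (1 - t ^ 2) ^ 2 = 1 - t ^ 2 := Real.sq_sqrt ha.le
    have hs0 : Real.sqrt (1 - t ^ 2) ≠ 0 := (Real.sqrt_pos.2 ha).ne'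
    simp only [id, Pi.add_apply, Pi.mul_apply, Pi.pow_apply, Pi.sub_apply]
    generalize Real.sqrt (1 - t ^ 2) = s at *
    generalize eval t (derivative (derivative p)) = r at *
    generalize eval t (derivative p) = q at *
    generalize eval t p = y at *
    have hB' := hB.ne'
    obtain ⟨B, hBB⟩ : ∃ B, B = M * (1 - t ^ 2) + 1 := ⟨_, rfl⟩
    rw [← hBB] at hB' ⊢
    field_simp
    rw [hsq, hBB, hM]
    simp only [Nat.add_one_sub_one, pow_one, Nat.cast_ofNat]
    linear_combination (4 * (M * (1 - t ^ 2) + 1) * (1 - t ^ 2) *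
      (2 * (1 - t ^ 2) * q - t * y)) * ode
  have hmax : S t ≤ S 0 := by
    rcases le_total 0 t with h | h
    · refine antitoneOn_of_deriv_nonpos (D := Set.Icc 0 t) (convex_Icc 0 t) ?_ ?_ ?_ ⟨le_rfl, h⟩
        ⟨h, le_rfl⟩ h
      · intro x hx
        exact (hd x (by nlinarith [hx.1, hx.2])).continuousAt.continuousWithinAt
      · intro x hx
        rw [interior_Icc] at hx
        exact (hd x (by nlinarith [hx.1, hx.2])).differentiableAt.differentiableWithinAt
      · intro x hx
        rw [interior_Icc] at hx
        have hx2 : 0 < 1 - x ^ 2 := by nlinarith [hx.1, hx.2]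
        rw [(hd x (by nlinarith [hx.1, hx.2])).deriv, neg_nonpos]
        have := hx.1
        positivity
    · refine monotoneOn_of_deriv_nonneg (D := Set.Icc t 0) (convex_Icc t 0) ?_ ?_ ?_ ⟨le_rfl, h⟩
        ⟨h, le_rfl⟩ h
      · intro x hx
        exact (hd x (by nlinarith [hx.1, hx.2])).continuousAt.continuousWithinAt
      · intro x hx
        rw [interior_Icc] at hx
        exact (hd x (by nlinarith [hx.1, hx.2])).differentiableAt.differentiableWithinAt
      · intro x hx
        rw [interior_Icc] at hx
        have hx2 : 0 < 1 - x ^ 2 := by nlinarith [hx.1, hx.2]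
        rw [(hd x (by nlinarith [hx.1, hx.2])).deriv, ← neg_div, ← neg_mul, ← mul_neg]
        have : 0 < -x := by linarith [hx.2]
        positivity
  have ha : 0 < 1 - t ^ 2 := by linarith
  have hB : 0 < M * (1 - t ^ 2) + 1 := by positivity
  have h1 : Real.sqrt (1 - t ^ 2) * p.eval t ^ 2 ≤ S t := by
    rw [hS]
    simp only
    rw [le_div_iff₀ hB, hN, mul_assoc]
    gcongr
    simp only
    nlinarith [sq_nonneg (2 * (1 - t ^ 2) * (derivative p).eval t - t * p.eval t)]
  have hE := legendrePoly_energy_zero_le hk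
  rw [← hp] at hE
  have h2 : S 0 ≤ 2 / (2 * (k : ℝ) + 1) := by
    have hl : (0 : ℝ) < k * (k + 1) := by positivity
    have h3 : 2 / (2 * (k : ℝ) + 1) = (2 * (k * (k + 1)) / (2 * (k : ℝ) + 1)) / (k * (k + 1)) := by
      field_simp
    rw [h3]
    refine le_trans ?_ (div_le_div_of_nonneg_right hE hl.le)
    simp [hS, hN]
    rw [div_le_div_iff₀ (by positivity) hl, hM]
    nlinarith [sq_nonneg (eval 0 (derivative p)), sq_nonneg (eval 0 p)]
  exact h1.trans (hmax.trans h2)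

theorem integral_exp_I_mul_int (n : ℤ) :
    ∫ θ in (-Real.pi)..Real.pi, Complex.exp (Complex.I * (n : ℂ) * (θ : ℂ)) =
      if n = 0 then 2 * (Real.pi : ℂ) else 0 := by
  split_ifs with h
  · subst h
    simp
    ring
  · have hc : Complex.I * (n : ℂ) ≠ 0 := by simp [h]
    rw [integral_exp_mul_complex hc, div_eq_zero_iff]
    left
    rw [sub_eq_zero, Complex.exp_eq_exp_iff_exists_int]
    refine ⟨n, ?_⟩
    push_cast
    ring

theorem sum_sq_additionCoeff_eq (k : ℕ) (t : ℝ) :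
    ∑ m ∈ Finset.Icc (-(k : ℤ)) (k : ℤ), (additionCoeff k m.natAbs).eval t ^ 2 =
      (2 * Real.pi)⁻¹ * ∫ θ in (-Real.pi)..Real.pi,
        (legendrePoly k).eval (t ^ 2 + (1 - t ^ 2) * Real.cos θ) ^ 2 := by
  set b : ℤ → ℂ := fun m => (((additionCoeff k m.natAbs).eval t : ℝ) : ℂ) with hb
  have hexp : ∀ θ : ℝ, (((legendrePoly k).eval (t ^ 2 + (1 - t ^ 2) * Real.cos θ) ^ 2 : ℝ) : ℂ) =
      ∑ m ∈ Finset.Icc (-(k : ℤ)) (k : ℤ), ∑ n ∈ Finset.Icc (-(k : ℤ)) (k : ℤ),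
        b m * b n * Complex.exp (Complex.I * ((m - n : ℤ) : ℂ) * (θ : ℂ)) := by
    intro θ
    have h1 := legendrePoly_addition k t θ
    have h2 := legendrePoly_addition k t (-θ)
    rw [Real.cos_neg] at h2
    rw [sq, Complex.ofReal_mul]
    nth_rewrite 1 [h1]
    rw [h2, Finset.sum_mul_sum]
    refine Finset.sum_congr rfl fun m _ => Finset.sum_congr rfl fun n _ => ?_
    rw [mul_mul_mul_comm, ← Complex.exp_add]
    congr 2
    push_cast
    ring
  have hint : ((∫ θ in (-Real.pi)..Real.pi,
      (legendrePoly k).eval (t ^ 2 + (1 - t ^ 2) * Real.cos θ) ^ 2 : ℝ) : ℂ) =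
      ∑ m ∈ Finset.Icc (-(k : ℤ)) (k : ℤ), 2 * Real.pi * b m ^ 2 := by
    rw [← intervalIntegral.integral_ofReal]
    simp only [hexp]
    have hi : ∀ m n : ℤ, IntervalIntegrable (fun θ : ℝ => b m * b n *
        Complex.exp (Complex.I * ((m - n : ℤ) : ℂ) * (θ : ℂ))) volume (-Real.pi) Real.pi :=
      fun m n => Continuous.intervalIntegrable (by fun_prop) _ _
    rw [intervalIntegral.integral_finsetSum
      (fun m _ => Continuous.intervalIntegrable (by fun_prop) _ _)]
    refine Finset.sum_congr rfl fun m hm => ?_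
    rw [intervalIntegral.integral_finsetSum (fun n _ => hi m n)]
    simp only [intervalIntegral.integral_const_mul, integral_exp_I_mul_int, sub_eq_zero, mul_ite,
      mul_zero]
    rw [Finset.sum_ite_eq, if_pos hm]
    ring
  have hpi : (Real.pi : ℂ) ≠ 0 := by exact_mod_cast Real.pi_ne_zero
  have : ((∑ m ∈ Finset.Icc (-(k : ℤ)) (k : ℤ), (additionCoeff k m.natAbs).eval t ^ 2 : ℝ) : ℂ) =
      (((2 * Real.pi)⁻¹ * ∫ θ in (-Real.pi)..Real.pi,
        (legendrePoly k).eval (t ^ 2 + (1 - t ^ 2) * Real.cos θ) ^ 2 : ℝ) : ℂ) := by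
    rw [Complex.ofReal_mul, hint, ← Finset.mul_sum]
    push_cast
    field_simp
    rfl
  exact_mod_cast this

theorem sq_eval_legendrePoly_le {k : ℕ} (hk : 1 ≤ k) {t θ : ℝ} (ht : t ^ 2 ≤ 1)
    (h0 : 0 ≤ θ) (hpi : θ ≤ Real.pi) :
    (legendrePoly k).eval (t ^ 2 + (1 - t ^ 2) * Real.cos θ) ^ 2 ≤
      2 / (1 + k * Real.sqrt (1 - t ^ 2) * Real.sin θ) := by
  have hk' : (0 : ℝ) < k := by exact_mod_cast hk
  have hs := Real.sin_nonneg_of_nonneg_of_le_pi h0 hpi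
  have hc := Real.sin_sq_add_cos_sq θ
  set x := t ^ 2 + (1 - t ^ 2) * Real.cos θ with hx
  have hle : (1 - t ^ 2) * Real.sin θ ^ 2 ≤ 1 - x ^ 2 := by
    have : 0 ≤ (1 - t ^ 2) * (1 - Real.cos θ) ^ 2 * t ^ 2 := by
      have : 0 ≤ 1 - t ^ 2 := by linarith
      positivity
    rw [show Real.sin θ ^ 2 = 1 - Real.cos θ ^ 2 by linarith, hx]
    nlinarith
  have hx1 : x ^ 2 ≤ 1 := by
    have : 0 ≤ (1 - t ^ 2) * Real.sin θ ^ 2 := by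
      have : 0 ≤ 1 - t ^ 2 := by linarith
      positivity
    linarith
  have h1 := sq_eval_legendrePoly_le_one k hx1
  have h2 := sqrt_mul_sq_eval_legendrePoly_le hk hx1
  have h3 : Real.sqrt (1 - t ^ 2) * Real.sin θ ≤ Real.sqrt (1 - x ^ 2) := by
    apply Real.le_sqrt_of_sq_le
    rw [mul_pow, Real.sq_sqrt (by linarith)]
    exact hle
  have h4 : Real.sqrt (1 - t ^ 2) * Real.sin θ * (legendrePoly k).eval x ^ 2 ≤ 1 / k := by
    refine (mul_le_mul_of_nonneg_right h3 (sq_nonneg _)).trans (h2.trans ?_)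
    rw [div_le_div_iff₀ (by positivity) hk']
    linarith
  rw [le_div_iff₀ (by positivity)]
  have h5 := mul_le_mul_of_nonneg_left h4 hk'.le
  rw [mul_one_div_cancel hk'.ne'] at h5
  linarith

theorem integral_two_div_one_add_mul_sin_le {A : ℝ} (hA : 0 < A) :
    ∫ θ in (0 : ℝ)..Real.pi, 2 / (1 + A * Real.sin θ) ≤
      2 * Real.pi / A * Real.log (1 + 2 * A) := by
  have hpi := Real.pi_pos
  set B : ℝ := 2 * A / Real.pi with hB
  have hB0 : 0 < B := by positivity
  have hd : ∀ θ ∈ Set.uIcc 0 Real.pi, HasDerivAt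
      (fun θ => 2 / B * (Real.log (1 + B * θ) - Real.log (1 + B * (Real.pi - θ))))
      (2 / (1 + B * θ) + 2 / (1 + B * (Real.pi - θ))) θ := by
    intro θ hθ
    rw [Set.uIcc_of_le hpi.le] at hθ
    have p1 : 0 < 1 + B * θ := by nlinarith [mul_nonneg hB0.le hθ.1]
    have p2 : 0 < 1 + B * (Real.pi - θ) := by nlinarith [mul_nonneg hB0.le (sub_nonneg.2 hθ.2)]
    have d1 : HasDerivAt (fun θ : ℝ => 1 + B * θ) B θ := by
      simpa using ((hasDerivAt_id θ).const_mul B).const_add 1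
    have d2 : HasDerivAt (fun θ : ℝ => 1 + B * (Real.pi - θ)) (-B) θ := by
      simpa using (((hasDerivAt_id θ).const_sub Real.pi).const_mul B).const_add 1
    refine (((d1.log p1.ne').sub (d2.log p2.ne')).const_mul (2 / B)).congr_deriv ?_
    field_simp
    ring
  have hcont : ContinuousOn (fun θ => 2 / (1 + B * θ) + 2 / (1 + B * (Real.pi - θ)))
      (Set.uIcc 0 Real.pi) := by
    rw [Set.uIcc_of_le hpi.le]
    refine ContinuousOn.add ?_ ?_
    · refine ContinuousOn.div (by fun_prop) (by fun_prop) fun θ hθ => ?_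
      nlinarith [mul_nonneg hB0.le hθ.1]
    · refine ContinuousOn.div (by fun_prop) (by fun_prop) fun θ hθ => ?_
      nlinarith [mul_nonneg hB0.le (sub_nonneg.2 hθ.2)]
  have hftc := intervalIntegral.integral_eq_sub_of_hasDerivAt hd hcont.intervalIntegrable
  have hcont2 : ContinuousOn (fun θ => 2 / (1 + A * Real.sin θ)) (Set.uIcc 0 Real.pi) := by
    rw [Set.uIcc_of_le hpi.le]
    refine ContinuousOn.div (by fun_prop) (by fun_prop) fun θ hθ => ?_
    nlinarith [mul_nonneg hA.le (Real.sin_nonneg_of_nonneg_of_le_pi hθ.1 hθ.2)]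
  have hmono := intervalIntegral.integral_mono_on (μ := volume) hpi.le hcont2.intervalIntegrable
    hcont.intervalIntegrable (fun θ hθ => by
      have p1 : 0 ≤ B * θ := mul_nonneg hB0.le hθ.1
      have p2 : 0 ≤ B * (Real.pi - θ) := mul_nonneg hB0.le (sub_nonneg.2 hθ.2)
      have q1 : 0 ≤ 2 / (1 + B * θ) := by positivity
      have q2 : 0 ≤ 2 / (1 + B * (Real.pi - θ)) := by positivity
      rcases le_total θ (Real.pi / 2) with h | h
      · have hs := Real.mul_le_sin hθ.1 h
        have : 2 / (1 + A * Real.sin θ) ≤ 2 / (1 + B * θ) := by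
          gcongr 2 / (1 + ?_)
          calc B * θ = A * (2 / Real.pi * θ) := by rw [hB]; ring
            _ ≤ A * Real.sin θ := by gcongr
        linarith
      · have hs := Real.mul_le_sin (sub_nonneg.2 hθ.2) (by linarith)
        rw [Real.sin_pi_sub] at hs
        have : 2 / (1 + A * Real.sin θ) ≤ 2 / (1 + B * (Real.pi - θ)) := by
          gcongr 2 / (1 + ?_)
          calc B * (Real.pi - θ) = A * (2 / Real.pi * (Real.pi - θ)) := by rw [hB]; ring
            _ ≤ A * Real.sin θ := by gcongr
        linarith)
  refine hmono.trans (le_of_eq ?_)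
  have hBpi : B * Real.pi = 2 * A := by rw [hB]; field_simp
  rw [hftc]
  simp only [sub_self, mul_zero, add_zero, Real.log_one, sub_zero, zero_sub, hBpi]
  rw [hB]
  field_simp
  ring

theorem sum_sq_additionCoeff_le {k : ℕ} (hk : 1 ≤ k) {t : ℝ} (ht : t ^ 2 < 1) :
    ∑ m ∈ Finset.Icc (-(k : ℤ)) (k : ℤ), (additionCoeff k m.natAbs).eval t ^ 2 ≤
      2 / (k * Real.sqrt (1 - t ^ 2)) * Real.log (1 + 2 * (k * Real.sqrt (1 - t ^ 2))) := by
  have hpi := Real.pi_pos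
  have hk' : (0 : ℝ) < k := by exact_mod_cast hk
  have hA : 0 < k * Real.sqrt (1 - t ^ 2) := mul_pos hk' (Real.sqrt_pos.2 (by linarith))
  set A := k * Real.sqrt (1 - t ^ 2) with hAdef
  have hc : Continuous fun θ : ℝ =>
      (legendrePoly k).eval (t ^ 2 + (1 - t ^ 2) * Real.cos θ) ^ 2 := by
    have := (legendrePoly k).continuous
    fun_prop
  have hright : ∫ θ in (0 : ℝ)..Real.pi,
      (legendrePoly k).eval (t ^ 2 + (1 - t ^ 2) * Real.cos θ) ^ 2 ≤
      2 * Real.pi / A * Real.log (1 + 2 * A) := by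
    refine le_trans ?_ (integral_two_div_one_add_mul_sin_le hA)
    refine intervalIntegral.integral_mono_on hpi.le (hc.intervalIntegrable _ _) ?_
      (fun θ hθ => sq_eval_legendrePoly_le hk ht.le hθ.1 hθ.2)
    refine ContinuousOn.intervalIntegrable ?_
    rw [Set.uIcc_of_le hpi.le]
    refine ContinuousOn.div (by fun_prop) (by fun_prop) fun θ hθ => ?_
    nlinarith [mul_nonneg hA.le (Real.sin_nonneg_of_nonneg_of_le_pi hθ.1 hθ.2)]
  have hleft : ∫ θ in (-Real.pi)..0,
      (legendrePoly k).eval (t ^ 2 + (1 - t ^ 2) * Real.cos θ) ^ 2 =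
      ∫ θ in (0 : ℝ)..Real.pi,
        (legendrePoly k).eval (t ^ 2 + (1 - t ^ 2) * Real.cos θ) ^ 2 := by
    have := intervalIntegral.integral_comp_neg (a := -Real.pi) (b := 0) (fun θ : ℝ =>
      (legendrePoly k).eval (t ^ 2 + (1 - t ^ 2) * Real.cos θ) ^ 2)
    simpa using this
  rw [sum_sq_additionCoeff_eq, ← intervalIntegral.integral_add_adjacent_intervals
    (hc.intervalIntegrable _ 0) (hc.intervalIntegrable _ _), hleft, ← two_mul]
  calc _ ≤ (2 * Real.pi)⁻¹ * (2 * (2 * Real.pi / A * Real.log (1 + 2 * A))) := by gcongr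
    _ = _ := by field_simp

end SphHarm

theorem integral_Ioi_pow_mul_exp_neg_sq (n : ℕ) :
    ∫ r in Set.Ioi (0 : ℝ), r ^ n * Real.exp (-r ^ 2) =
      1 / 2 * Real.Gamma (((n : ℝ) + 1) / 2) := by
  rw [← integral_rpow_mul_exp_neg_rpow (p := 2) (q := n) (by norm_num)
    (by have : (0 : ℝ) ≤ n := Nat.cast_nonneg n
        linarith)]
  refine setIntegral_congr_fun measurableSet_Ioi fun r _ => ?_
  simp

theorem integral_pow_mul_exp_neg_sq (n : ℕ) :
    ∫ r : ℝ, r ^ n * Real.exp (-r ^ 2) =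
      (1 + (-1) ^ n) / 2 * Real.Gamma (((n : ℝ) + 1) / 2) := by
  rcases Nat.even_or_odd n with h | h
  · have h1 : ∀ r : ℝ, r ^ n * Real.exp (-r ^ 2) = |r| ^ n * Real.exp (-|r| ^ 2) := by
      intro r; rw [h.pow_abs, sq_abs]
    rw [integral_congr_ae (Filter.Eventually.of_forall h1), integral_comp_abs (f := fun r => r ^ n * Real.exp (-r ^ 2)),
      integral_Ioi_pow_mul_exp_neg_sq, h.neg_one_pow]
    ring
  · have h1 := integral_neg_eq_self (fun r : ℝ => r ^ n * Real.exp (-r ^ 2)) volume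
    simp only [h.neg_pow, neg_sq, neg_mul, integral_neg, one_pow] at h1 ⊢
    linarith

namespace SphHarm

instance : IsFiniteMeasure dV := by unfold dV; infer_instance

theorem integral_dV_mul_integral_Ioi (n : ℕ) :
    (∫ x : S2, (x.1 2) ^ n ∂dV) * ∫ r in Set.Ioi (0 : ℝ), r ^ (n + 2) * Real.exp (-r ^ 2) =
      ∫ y : EuclideanSpace ℝ (Fin 3), (y 2) ^ n * Real.exp (-‖y‖ ^ 2) := by
  symm
  have hdim : Module.finrank ℝ (EuclideanSpace ℝ (Fin 3)) - 1 = 2 := by simp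
  calc ∫ y : EuclideanSpace ℝ (Fin 3), (y 2) ^ n * Real.exp (-‖y‖ ^ 2)
      = ∫ y : ({0}ᶜ : Set (EuclideanSpace ℝ (Fin 3))), (y.1 2) ^ n * Real.exp (-‖y.1‖ ^ 2)
          ∂((volume : Measure (EuclideanSpace ℝ (Fin 3))).comap (↑)) := by
        rw [integral_subtype_comap (measurableSet_singleton _).compl
          (fun y : EuclideanSpace ℝ (Fin 3) => (y 2) ^ n * Real.exp (-‖y‖ ^ 2)),
          restrict_compl_singleton]
    _ = ∫ z : S2 × Set.Ioi (0 : ℝ), (z.1.1 2) ^ n * (z.2.1 ^ n * Real.exp (-z.2.1 ^ 2))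
          ∂(dV.prod (Measure.volumeIoiPow 2)) := by
        have h := (volume : Measure
          (EuclideanSpace ℝ (Fin 3))).measurePreserving_homeomorphUnitSphereProd.integral_comp
          (Homeomorph.measurableEmbedding _) (fun z : S2 × Set.Ioi (0 : ℝ) =>
            (z.1.1 2) ^ n * (z.2.1 ^ n * Real.exp (-z.2.1 ^ 2)))
        rw [hdim] at h
        rw [dV, ← h]
        refine integral_congr_ae (Filter.Eventually.of_forall fun y => ?_)
        have hy : ‖y.1‖ ≠ 0 := norm_ne_zero_iff.2 y.2
        simp [mul_pow]
        field_simp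
    _ = (∫ x : S2, (x.1 2) ^ n ∂dV) *
          ∫ r : Set.Ioi (0 : ℝ), (r.1 ^ n * Real.exp (-r.1 ^ 2)) ∂(Measure.volumeIoiPow 2) :=
        integral_prod_mul (fun x : S2 => (x.1 2) ^ n)
          (fun r : Set.Ioi (0 : ℝ) => r.1 ^ n * Real.exp (-r.1 ^ 2))
    _ = _ := by
        congr 1
        simp only [Measure.volumeIoiPow, ENNReal.ofReal]
        rw [integral_withDensity_eq_integral_smul
            (measurable_subtype_coe.pow_const _).real_toNNReal,
          integral_subtype_comap measurableSet_Ioi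
            (fun a : ℝ => Real.toNNReal (a ^ 2) • (a ^ n * Real.exp (-a ^ 2)))]
        refine setIntegral_congr_fun measurableSet_Ioi fun r hr => ?_
        simp only [NNReal.smul_def, Real.coe_toNNReal _ (sq_nonneg r), smul_eq_mul]
        ring

theorem integral_coord_pow_mul_exp_neg_norm_sq (n : ℕ) :
    ∫ y : EuclideanSpace ℝ (Fin 3), (y 2) ^ n * Real.exp (-‖y‖ ^ 2) =
      Real.pi * ((1 + (-1) ^ n) / 2 * Real.Gamma (((n : ℝ) + 1) / 2)) := by
  have h1 : ∫ y : EuclideanSpace ℝ (Fin 3), (y 2) ^ n * Real.exp (-‖y‖ ^ 2) =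
      ∫ y : Fin 3 → ℝ, ∏ i, (y i ^ (![0, 0, n] i) * Real.exp (-y i ^ 2)) := by
    rw [← (EuclideanSpace.volume_preserving_symm_measurableEquiv_toLp (Fin 3)).integral_comp'
      (g := fun y : Fin 3 → ℝ => ∏ i, (y i ^ (![0, 0, n] i) * Real.exp (-y i ^ 2)))]
    refine integral_congr_ae (Filter.Eventually.of_forall fun y => ?_)
    simp only [EuclideanSpace.real_norm_sq_eq, Fin.prod_univ_three, Fin.sum_univ_three, neg_add,
      Real.exp_add]
    simp
    ring
  rw [h1, integral_fintype_prod_volume_eq_prod (fun (i : Fin 3) (r : ℝ) =>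
    r ^ (![0, 0, n] i) * Real.exp (-r ^ 2)), Fin.prod_univ_three]
  simp only [integral_pow_mul_exp_neg_sq]
  have h2 : Real.Gamma (1 / 2) * Real.Gamma (1 / 2) = Real.pi := by
    rw [Real.Gamma_one_half_eq, Real.mul_self_sqrt Real.pi_pos.le]
  rw [← h2]
  simp

theorem integral_dV_coord_pow (n : ℕ) :
    ∫ x : S2, (x.1 2) ^ n ∂dV = 2 * Real.pi * ∫ t in (-1 : ℝ)..1, t ^ n := by
  have h := integral_dV_mul_integral_Ioi n
  have hn : (0 : ℝ) < (n : ℝ) + 1 := by positivity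
  have hG : 0 < Real.Gamma (((n : ℝ) + 1) / 2) := Real.Gamma_pos_of_pos (by positivity)
  rw [integral_coord_pow_mul_exp_neg_norm_sq, integral_Ioi_pow_mul_exp_neg_sq,
    show (((n + 2 : ℕ) : ℝ) + 1) / 2 = ((n : ℝ) + 1) / 2 + 1 by push_cast; ring,
    Real.Gamma_add_one (by positivity)] at h
  rw [integral_pow]
  have h2 : (1 / 2 * ((((n : ℝ) + 1) / 2) * Real.Gamma (((n : ℝ) + 1) / 2))) ≠ 0 := by positivity
  apply mul_right_cancel₀ h2
  rw [h]
  field_simp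
  ring

theorem continuous_coord : Continuous fun x : S2 => x.1 2 := by
  fun_prop

theorem integrable_dV_of_continuous {f : S2 → ℝ} (hf : Continuous f) : Integrable f dV :=
  hf.integrable_of_hasCompactSupport (HasCompactSupport.of_compactSpace f)

theorem integral_dV_polynomial (p : Polynomial ℝ) :
    ∫ x : S2, p.eval (x.1 2) ∂dV = 2 * Real.pi * ∫ t in (-1 : ℝ)..1, p.eval t := by
  simp only [Polynomial.eval_eq_sum_range]
  rw [integral_finsetSum _ fun n _ => integrable_dV_of_continuous (by fun_prop),
    intervalIntegral.integral_finsetSum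
      fun n _ => Continuous.intervalIntegrable (by fun_prop) _ _, Finset.mul_sum]
  refine Finset.sum_congr rfl fun n _ => ?_
  rw [integral_const_mul, intervalIntegral.integral_const_mul, integral_dV_coord_pow]
  ring

theorem coord_sq_le_one (x : S2) : (x.1 2) ^ 2 ≤ 1 := by
  have h : ‖x.1‖ ^ 2 = 1 := by rw [norm_eq_of_mem_sphere x, one_pow]
  rw [EuclideanSpace.real_norm_sq_eq, Fin.sum_univ_three] at h
  nlinarith [sq_nonneg (x.1 0), sq_nonneg (x.1 1)]

theorem cos_polarAngle (x : S2) : Real.cos (polarAngle x) = x.1 2 := by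
  have h := abs_le.1 ((sq_le_one_iff_abs_le_one _).1 (coord_sq_le_one x))
  exact Real.cos_arccos h.1 h.2

theorem sq_legendreFunNat (k n : ℕ) {t : ℝ} (ht : t ^ 2 ≤ 1) :
    legendreFunNat k n t ^ 2 =
      ((Nat.factorial (k + n) : ℝ) / (Nat.factorial (k - n) : ℝ)) * (additionCoeff k n).eval t := by
  have h1 : ((k + n).factorial : ℝ) ≠ 0 := by exact_mod_cast (k + n).factorial_ne_zero
  have h2 : ((k - n).factorial : ℝ) ≠ 0 := by exact_mod_cast (k - n).factorial_ne_zero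
  have h3 : (Real.sqrt (1 - t ^ 2) ^ n) ^ 2 = (1 - t ^ 2) ^ n := by
    rw [← pow_mul, mul_comm, pow_mul, Real.sq_sqrt (by linarith)]
  have h4 : ((-1 : ℝ) ^ n) ^ 2 = 1 := by rw [← pow_mul, mul_comm, pow_mul]; simp
  rw [legendreFunNat, mul_pow, mul_pow, h3, h4]
  simp [additionCoeff]
  field_simp

theorem exists_sq_norm_unnormalizedY_eq (k : ℕ) (m : ℤ) :
    ∃ d : ℝ, 0 < d ∧ ∀ x : S2,
      ‖unnormalizedY k m x‖ ^ 2 = d * (additionCoeff k m.natAbs).eval (x.1 2) := by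
  set n := m.natAbs with hn
  have h1 : (0 : ℝ) < (k + n).factorial := by exact_mod_cast (k + n).factorial_pos
  have h2 : (0 : ℝ) < (k - n).factorial := by exact_mod_cast (k - n).factorial_pos
  have hnorm : ∀ x : S2, ‖unnormalizedY k m x‖ ^ 2 = legendreFun k m (x.1 2) ^ 2 := by
    intro x
    have he : ‖Complex.exp (Complex.I * (m : ℂ) * (azimuth x : ℂ))‖ = 1 := by
      rw [Complex.norm_exp]; simp
    rw [unnormalizedY, norm_mul, he, mul_one, Complex.norm_real, Real.norm_eq_abs, sq_abs,
      cos_polarAngle]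
  have h4 : ((-1 : ℝ) ^ n) ^ 2 = 1 := by rw [← pow_mul, mul_comm, pow_mul]; simp
  by_cases hm : 0 ≤ m
  · refine ⟨(k + n).factorial / (k - n).factorial, by positivity, fun x => ?_⟩
    rw [hnorm, legendreFun, if_pos hm, sq_legendreFunNat k _ (coord_sq_le_one x)]
  · refine ⟨(k - n).factorial / (k + n).factorial, by positivity, fun x => ?_⟩
    rw [hnorm, legendreFun, if_neg hm, mul_pow, sq_legendreFunNat k _ (coord_sq_le_one x), mul_pow,
      ← hn, h4]
    field_simp

theorem sq_norm_Y {k : ℕ} {m : ℤ} (hm : m.natAbs ≤ k) (x : S2) :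
    ‖Y k m x‖ ^ 2 =
      (2 * (k : ℝ) + 1) / (4 * Real.pi) * (additionCoeff k m.natAbs).eval (x.1 2) := by
  obtain ⟨d, hd, h⟩ := exists_sq_norm_unnormalizedY_eq k m
  have hpi := Real.pi_pos
  have hint : ∫ x : S2, ‖unnormalizedY k m x‖ ^ 2 ∂dV = d * (4 * Real.pi / (2 * (k : ℝ) + 1)) := by
    simp only [h]
    rw [integral_const_mul, integral_dV_polynomial, integral_additionCoeff hm]
    ring
  rw [Y, norm_mul, mul_pow, h, Complex.norm_real, Real.norm_eq_abs, sq_abs, normConst, hint,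
    inv_pow, Real.sq_sqrt (by positivity)]
  field_simp

theorem norm_Y_pow_four {k : ℕ} {m : ℤ} (hm : m ∈ Finset.Icc (-(k : ℤ)) (k : ℤ)) (x : S2) :
    ‖Y k m x‖ ^ 4 = ((2 * (k : ℝ) + 1) / (4 * Real.pi)) ^ 2 *
      (additionCoeff k m.natAbs ^ 2).eval (x.1 2) := by
  rw [show 4 = 2 * 2 by norm_num, pow_mul, sq_norm_Y (by simp at hm; omega), mul_pow,
    Polynomial.eval_pow]

theorem sum_norm_Y_pow_four (k : ℕ) (x : S2) :
    ∑ m ∈ Finset.Icc (-(k : ℤ)) (k : ℤ), ‖Y k m x‖ ^ 4 =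
      ((2 * (k : ℝ) + 1) / (4 * Real.pi)) ^ 2 *
        ∑ m ∈ Finset.Icc (-(k : ℤ)) (k : ℤ), (additionCoeff k m.natAbs).eval (x.1 2) ^ 2 := by
  rw [Finset.mul_sum]
  refine Finset.sum_congr rfl fun m hm => ?_
  rw [norm_Y_pow_four hm, Polynomial.eval_pow]

theorem two_mul_add_one_div_four_pi_le {k : ℕ} (hk : 1 ≤ k) :
    (2 * (k : ℝ) + 1) / (4 * Real.pi) ≤ k / 4 := by
  have hk' : (1 : ℝ) ≤ k := by exact_mod_cast hk
  rw [div_le_div_iff₀ (by positivity) (by norm_num)]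
  nlinarith [Real.pi_gt_three]

theorem sum_norm_Y_pow_four_le {k : ℕ} (hk : 1 ≤ k) (x : S2) :
    ∑ m ∈ Finset.Icc (-(k : ℤ)) (k : ℤ), ‖Y k m x‖ ^ 4 ≤ (k : ℝ) ^ 2 := by
  have hb := fun m : ℤ => additionCoeff_nonneg k m.natAbs (coord_sq_le_one x)
  have h1 : ∑ m ∈ Finset.Icc (-(k : ℤ)) (k : ℤ), (additionCoeff k m.natAbs).eval (x.1 2) ^ 2 ≤ 1 := by
    refine le_trans ?_ (sum_additionCoeff k (x.1 2)).le
    refine Finset.sum_le_sum fun m hm => ?_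
    have h2 := Finset.single_le_sum (f := fun m : ℤ => (additionCoeff k m.natAbs).eval (x.1 2))
      (fun m _ => hb m) hm
    rw [sum_additionCoeff] at h2
    simp only at h2
    nlinarith [hb m]
  rw [sum_norm_Y_pow_four]
  calc _ ≤ ((k : ℝ) / 4) ^ 2 * 1 := by
        exact mul_le_mul (pow_le_pow_left₀ (by positivity) (two_mul_add_one_div_four_pi_le hk) 2)
          h1 (Finset.sum_nonneg fun m _ => sq_nonneg _) (by positivity)
    _ ≤ (k : ℝ) ^ 2 := by nlinarith [sq_nonneg (k : ℝ)]

theorem log_one_add_two_mul_le {y : ℝ} (hy : 2 ≤ y) :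
    Real.log (1 + 2 * y) ≤ 3 * Real.log y := by
  have : 3 * Real.log y = Real.log (y ^ 3) := by rw [Real.log_pow]; norm_num
  rw [this]
  apply Real.log_le_log (by linarith)
  nlinarith [mul_nonneg (sub_nonneg.2 hy) (sub_nonneg.2 hy)]

theorem poleDist_eq (x : S2) :
    poleDist x = min (polarAngle x) (Real.pi - polarAngle x) := by
  have h : InnerProductGeometry.angle x.1 northPole = polarAngle x := by
    rw [InnerProductGeometry.angle, polarAngle]
    have hn : ‖northPole‖ = 1 := by
      rw [northPole, EuclideanSpace.norm_eq, Fin.sum_univ_three]; simp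
    have hi : inner ℝ x.1 northPole = x.1 2 := by
      simp [northPole, PiLp.inner_apply, Fin.sum_univ_three]
    rw [hn, hi, norm_eq_of_mem_sphere x]
    simp
  rw [poleDist, InnerProductGeometry.angle_neg_right, h]

theorem sum_norm_Y_pow_four_le_of_le_poleDist {k : ℕ} (hk : 1 ≤ k) (x : S2)
    (hx : 2 / (k : ℝ) ≤ poleDist x) :
    ∑ m ∈ Finset.Icc (-(k : ℤ)) (k : ℤ), ‖Y k m x‖ ^ 4 ≤
      k * (poleDist x)⁻¹ * Real.log (k * poleDist x) := by
  have hk' : (0 : ℝ) < k := by exact_mod_cast hk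
  set r := poleDist x with hr
  have hr0 : 0 < r := lt_of_lt_of_le (by positivity) hx
  have hkr : 2 ≤ k * r := by rwa [div_le_iff₀ hk', mul_comm] at hx
  have hsin : Real.sqrt (1 - (x.1 2) ^ 2) = Real.sin (polarAngle x) := by
    rw [polarAngle, Real.sin_arccos]
  have hr2 : r ≤ Real.pi / 2 := by
    have h1 := min_le_left (polarAngle x) (Real.pi - polarAngle x)
    have h2 := min_le_right (polarAngle x) (Real.pi - polarAngle x)
    rw [hr, poleDist_eq]
    linarith
  have hs : Real.sqrt (1 - (x.1 2) ^ 2) = Real.sin r := by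
    rw [hsin, hr, poleDist_eq]
    rcases min_choice (polarAngle x) (Real.pi - polarAngle x) with h | h
    · rw [h]
    · rw [h, Real.sin_pi_sub]
  have hs1 : 2 / Real.pi * r ≤ Real.sin r := Real.mul_le_sin hr0.le hr2
  have hs2 : Real.sin r ≤ r := Real.sin_le hr0.le
  have hpi := Real.pi_pos
  have hs0 : 0 < Real.sin r := lt_of_lt_of_le (by positivity) hs1
  have ht : (x.1 2) ^ 2 < 1 := by
    rw [← hs, Real.sqrt_pos] at hs0
    linarith
  have hmain := sum_sq_additionCoeff_le hk ht
  rw [hs] at hmain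
  have hlog : Real.log (1 + 2 * (k * Real.sin r)) ≤ 3 * Real.log (k * r) := by
    refine le_trans (Real.log_le_log (by positivity) ?_) (log_one_add_two_mul_le hkr)
    gcongr
  have hlog0 : 0 ≤ Real.log (k * r) := Real.log_nonneg (by linarith)
  have hc := two_mul_add_one_div_four_pi_le hk
  rw [sum_norm_Y_pow_four]
  calc _ ≤ ((k : ℝ) / 4) ^ 2 * (2 / (k * (2 / Real.pi * r)) * (3 * Real.log (k * r))) := by
        refine mul_le_mul (pow_le_pow_left₀ (by positivity) hc 2) (hmain.trans ?_)
          (Finset.sum_nonneg fun m _ => sq_nonneg _) (by positivity)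
        refine mul_le_mul ?_ hlog (Real.log_nonneg ?_) (by positivity)
        · gcongr
        · have : 0 ≤ 2 * (k * Real.sin r) := by positivity
          linarith
    _ = (3 * Real.pi / 16) * (k * r⁻¹ * Real.log (k * r)) := by
        field_simp
        ring
    _ ≤ 1 * (k * r⁻¹ * Real.log (k * r)) := by
        gcongr
        linarith [Real.pi_lt_four]
    _ = _ := one_mul _

theorem integral_sum_sq_additionCoeff_le {k : ℕ} (hk : 2 ≤ k) :
    ∫ t in (-1 : ℝ)..1, (∑ m ∈ Finset.Icc (-(k : ℤ)) (k : ℤ), additionCoeff k m.natAbs ^ 2).eval t ≤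
      6 * Real.pi / k * Real.log k := by
  have hk' : (0 : ℝ) < k := by exact_mod_cast (by omega : 0 < k)
  have hpi := Real.pi_pos
  set Q := ∑ m ∈ Finset.Icc (-(k : ℤ)) (k : ℤ), additionCoeff k m.natAbs ^ 2 with hQ
  have hQe : ∀ t, Q.eval t =
      ∑ m ∈ Finset.Icc (-(k : ℤ)) (k : ℤ), (additionCoeff k m.natAbs).eval t ^ 2 := by
    intro t; simp [hQ, Polynomial.eval_finsetSum]
  have hsub := intervalIntegral.integral_comp_mul_deriv (a := 0) (b := Real.pi)
    (f := Real.cos) (f' := fun φ => -Real.sin φ) (g := fun t => Q.eval t)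
    (fun φ _ => Real.hasDerivAt_cos φ) (by fun_prop) Q.continuous
  rw [Real.cos_zero, Real.cos_pi, intervalIntegral.integral_symm (-1) 1] at hsub
  have hcont : Continuous fun φ : ℝ => Q.eval (Real.cos φ) * Real.sin φ :=
    (Q.continuous.comp Real.continuous_cos).mul Real.continuous_sin
  have hle : ∫ φ in (0 : ℝ)..Real.pi, Q.eval (Real.cos φ) * Real.sin φ ≤
      ∫ φ in (0 : ℝ)..Real.pi, 6 / k * Real.log k := by
    refine intervalIntegral.integral_mono_on hpi.le (hcont.intervalIntegrable _ _) (by simp)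
      fun φ hφ => ?_
    have hlogk : 0 ≤ Real.log k := Real.log_natCast_nonneg k
    rcases (Real.sin_nonneg_of_nonneg_of_le_pi hφ.1 hφ.2).eq_or_lt with hs | hs
    · rw [← hs, mul_zero]; positivity
    have hsc := Real.sin_sq_add_cos_sq φ
    have hsq : Real.sqrt (1 - Real.cos φ ^ 2) = Real.sin φ := by
      rw [← Real.sin_sq, Real.sqrt_sq hs.le]
    have h := sum_sq_additionCoeff_le (k := k) (by omega) (t := Real.cos φ) (by nlinarith)
    rw [hsq, ← hQe] at h
    have hlog : Real.log (1 + 2 * (k * Real.sin φ)) ≤ 3 * Real.log k := by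
      refine le_trans (Real.log_le_log (by positivity) ?_)
        (log_one_add_two_mul_le (y := k) (by exact_mod_cast hk))
      have := mul_le_of_le_one_right hk'.le (Real.sin_le_one φ)
      linarith
    calc _ ≤ 2 / (k * Real.sin φ) * (3 * Real.log k) * Real.sin φ := by
          refine mul_le_mul_of_nonneg_right (h.trans ?_) hs.le
          gcongr
      _ = _ := by field_simp; ring
  rw [intervalIntegral.integral_const] at hle
  simp only [Function.comp, mul_neg, intervalIntegral.integral_neg, neg_inj] at hsub
  rw [← hsub]
  refine hle.trans (le_of_eq ?_)
  simp
  ring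

theorem integrable_norm_Y_pow_four {k : ℕ} {m : ℤ} (hm : m ∈ Finset.Icc (-(k : ℤ)) (k : ℤ)) :
    Integrable (fun x : S2 => ‖Y k m x‖ ^ 4) dV := by
  simp only [norm_Y_pow_four hm]
  exact integrable_dV_of_continuous
    (continuous_const.mul ((Polynomial.continuous _).comp continuous_coord))

theorem mean_integral_norm_Y_pow_four_le {k : ℕ} (hk : 2 ≤ k) :
    1 / (2 * (k : ℝ) + 1) * ∑ m ∈ Finset.Icc (-(k : ℤ)) (k : ℤ), ∫ x : S2, ‖Y k m x‖ ^ 4 ∂dV ≤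
      3 * Real.log k := by
  have hk' : (2 : ℝ) ≤ k := by exact_mod_cast hk
  have hpi := Real.pi_pos
  have hlogk : 0 ≤ Real.log k := Real.log_natCast_nonneg k
  have h := integral_sum_sq_additionCoeff_le hk
  rw [← integral_finsetSum _ fun m hm => integrable_norm_Y_pow_four hm]
  have heq : ∀ x : S2, ∑ m ∈ Finset.Icc (-(k : ℤ)) (k : ℤ), ‖Y k m x‖ ^ 4 =
      ((2 * (k : ℝ) + 1) / (4 * Real.pi)) ^ 2 *
        (∑ m ∈ Finset.Icc (-(k : ℤ)) (k : ℤ), additionCoeff k m.natAbs ^ 2).eval (x.1 2) := by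
    intro x; rw [sum_norm_Y_pow_four]; simp [Polynomial.eval_finsetSum]
  simp only [heq]
  rw [integral_const_mul, integral_dV_polynomial]
  calc _ ≤ 1 / (2 * (k : ℝ) + 1) * (((2 * (k : ℝ) + 1) / (4 * Real.pi)) ^ 2 *
        (2 * Real.pi * (6 * Real.pi / k * Real.log k))) := by gcongr
    _ = (3 * (2 * (k : ℝ) + 1) / (4 * k)) * Real.log k := by field_simp; ring
    _ ≤ 3 * Real.log k := by
        gcongr
        rw [div_le_iff₀ (by positivity)]
        linarith

end SphHarm

theorem mainTheorem2 :
    ∃ C : ℝ,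
      (∀ k : ℕ, 2 ≤ k →
        (∀ m ∈ Finset.Icc (-(k : ℤ)) (k : ℤ),
          Integrable (fun x : SphHarm.S2 => ‖SphHarm.Y k m x‖ ^ 4) SphHarm.dV) ∧
        1 / (2 * (k : ℝ) + 1) * ∑ m ∈ Finset.Icc (-(k : ℤ)) (k : ℤ),
            ∫ x : SphHarm.S2, ‖SphHarm.Y k m x‖ ^ 4 ∂SphHarm.dV
          ≤ C * Real.log (k : ℝ)) ∧
      (∀ k : ℕ, 1 ≤ k → ∀ x : SphHarm.S2,
        (2 / (k : ℝ) ≤ SphHarm.poleDist x →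
          (∑ m ∈ Finset.Icc (-(k : ℤ)) (k : ℤ), ‖SphHarm.Y k m x‖ ^ 4) ^ (1 / 4 : ℝ)
            ≤ C * (k : ℝ) ^ (1 / 4 : ℝ) * SphHarm.poleDist x ^ (-(1 / 4) : ℝ) *
                Real.log ((k : ℝ) * SphHarm.poleDist x) ^ (1 / 4 : ℝ)) ∧
        (SphHarm.poleDist x ≤ 2 / (k : ℝ) →
          (∑ m ∈ Finset.Icc (-(k : ℤ)) (k : ℤ), ‖SphHarm.Y k m x‖ ^ 4) ^ (1 / 4 : ℝ)
            ≤ C * (k : ℝ) ^ (1 / 2 : ℝ))) := by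
  refine ⟨3, fun k hk => ⟨fun m hm => SphHarm.integrable_norm_Y_pow_four hm,
    SphHarm.mean_integral_norm_Y_pow_four_le hk⟩, fun k hk x => ⟨fun hx => ?_, fun _ => ?_⟩⟩
  · have hk' : (0 : ℝ) < k := by exact_mod_cast hk
    have hr0 : 0 < SphHarm.poleDist x := lt_of_lt_of_le (by positivity) hx
    have hlog : 0 ≤ Real.log (k * SphHarm.poleDist x) := by
      rw [div_le_iff₀ hk', mul_comm] at hx
      exact Real.log_nonneg (by linarith)
    have h := Real.rpow_le_rpow (Finset.sum_nonneg fun m _ => by positivity)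
      (SphHarm.sum_norm_Y_pow_four_le_of_le_poleDist hk x hx) (show (0 : ℝ) ≤ 1 / 4 by norm_num)
    refine h.trans ?_
    rw [Real.mul_rpow (by positivity) hlog, Real.mul_rpow hk'.le (by positivity),
      Real.inv_rpow hr0.le, ← Real.rpow_neg hr0.le, mul_assoc 3, mul_assoc 3]
    exact le_mul_of_one_le_left (by positivity) (by norm_num)
  · have hk' : (0 : ℝ) < k := by exact_mod_cast hk
    have h := Real.rpow_le_rpow (Finset.sum_nonneg fun m _ => by positivity)
      (SphHarm.sum_norm_Y_pow_four_le hk x) (show (0 : ℝ) ≤ 1 / 4 by norm_num)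
    refine h.trans ?_
    rw [← Real.rpow_natCast, ← Real.rpow_mul hk'.le,
      show ((2 : ℕ) : ℝ) * (1 / 4) = 1 / 2 by norm_num]
    exact le_mul_of_one_le_left (by positivity) (by norm_num)
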